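/- Let $G$ be a finite abelian group. A sequence over $G$ is a finite multiset $S$ of elements of $G$; it is zero-sum free if no nonempty subsequence of $S$ has sum $0$, and its cross number is $\mathsf{k}(S)=\sum_{g\in S}\frac{1}{\operatorname{ord}(g)}$ (terms counted with multiplicity). The little cross number of $G$ is $$\mathsf{k}(G)=\max\{\mathsf{k}(S) : S \text{ a zero-sum free sequence over } G\}.$$ Writing $G\cong\bigoplus_{i=1}^{r}C_{p_i^{\alpha_i}}$ with primes $p_i$ (not necessarily distinct), where $C_N$ is the cyclic group of order $N$, put $\mathsf{k}^\star(G)=\sum_{i=1}^{r}\bigl(1-p_i^{-\alpha_i}\bigr)$. Let $\exp(G)$ be the exponent of $G$. A prime $p$ is called 2-small with respect to a positive integer $N$ if $p\nmid N$ and $$\frac{2p+2}{2p+1}>\sum_{d\mid N}\frac1d .$$ Theorem. Let $G$ be a finite abelian group, let $p$ be a prime that is 2-small with respect to $\exp(G)$, and let $m,n\ge 0$ be integers. Then $$\mathsf{k}(C_{p^m}\oplus C_{p^n}\oplus G)=\mathsf{k}(C_{p^m})+\mathsf{k}(C_{p^n})+\mathsf{k}(G).$$ In particular, if $\mathsf{k}(G)=\mathsf{k}^\star(G)$,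 then $$\mathsf{k}(C_{p^m}\oplus C_{p^n}\oplus G)=\mathsf{k}^\star(C_{p^m}\oplus C_{p^n}\oplus G).$$ -/

import Mathlib

namespace CrossNumber

/-- A sequence over `G` is a finite multiset of elements of `G`; its subsequences are the multisets
`T ≤ S`. It is zero-sum free if the empty sequence is its only subsequence with sum `0`. -/
def ZeroSumFree {G : Type*} [AddCommGroup G] (S : Multiset G) : Prop :=
  ∀ T : Multiset G, T ≤ S → T.sum = 0 → T = 0

/-- The cross number of a sequence: the sum of `1 / ord(g)` over its terms, with multiplicity. -/
noncomputable def crossNumber {G : Type*} [AddCommGroup G] (S : Multiset G) : ℝ :=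
  (S.map fun g => 1 / (addOrderOf g : ℝ)).sum

/-- The set of cross numbers of the zero-sum free sequences over `G`. -/
def zeroSumFreeCrossNumbers (G : Type*) [AddCommGroup G] : Set ℝ :=
  {x | ∃ S : Multiset G, ZeroSumFree S ∧ crossNumber S = x}

/-- The little cross number `k(G)`: the largest cross number of a zero-sum free sequence over `G`.
For finite `G` the maximum exists, see `littleCrossNumber_isGreatest`. -/
noncomputable def littleCrossNumber (G : Type*) [AddCommGroup G] : ℝ :=
  sSup (zeroSumFreeCrossNumbers G)

theorem zeroSumFreeCrossNumbers_finite (G : Type*) [AddCommGroup G] [Finite G] :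
    (zeroSumFreeCrossNumbers G).Finite := by
  classical
  cases nonempty_fintype G
  have hfin : {S : Multiset G | ZeroSumFree S}.Finite := by
    refine (Set.finite_Iic (∑ g : G, Multiset.replicate (addOrderOf g) g)).subset ?_
    intro S hS
    rw [Set.mem_Iic, Multiset.le_iff_count]
    intro g
    have hle : S.count g ≤ addOrderOf g := by
      by_contra hlt
      have h1 : Multiset.replicate (addOrderOf g) g ≤ S :=
        Multiset.le_count_iff_replicate_le.1 (by omega)
      have h2 := hS _ h1 (by simp [addOrderOf_nsmul_eq_zero])
      have h3 := congrArg Multiset.card h2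
      have h4 := addOrderOf_pos g
      rw [Multiset.card_replicate, Multiset.card_zero] at h3
      omega
    refine hle.trans ?_
    rw [Multiset.count_sum']
    refine le_trans (le_of_eq ?_) (Finset.single_le_sum
      (f := fun x => Multiset.count g (Multiset.replicate (addOrderOf x) x))
      (fun _ _ => Nat.zero_le _) (Finset.mem_univ g))
    simp
  refine (hfin.image crossNumber).subset ?_
  rintro x ⟨S, hS, rfl⟩
  exact ⟨S, hS, rfl⟩

/-- Over a finite group the little cross number is a maximum. -/
theorem littleCrossNumber_isGreatest (G : Type*) [AddCommGroup G] [Finite G] :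
    IsGreatest (zeroSumFreeCrossNumbers G) (littleCrossNumber G) := by
  have hne : (zeroSumFreeCrossNumbers G).Nonempty :=
    ⟨_, 0, fun T hT _ => Multiset.le_zero.1 hT, rfl⟩
  exact ⟨hne.csSup_mem (zeroSumFreeCrossNumbers_finite G),
    fun x hx => le_csSup (zeroSumFreeCrossNumbers_finite G).bddAbove hx⟩

/-- `G` is the direct sum of the cyclic groups of prime power orders `p i ^ a i`. -/
def IsPrimePowerDecomposition (G : Type*) [AddCommGroup G] {ι : Type*} (p a : ι → ℕ) : Prop :=
  (∀ i, (p i).Prime) ∧ Nonempty (G ≃+ ((i : ι) → ZMod (p i ^ a i)))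

theorem exists_isPrimePowerDecomposition (G : Type*) [AddCommGroup G] [Finite G] :
    ∃ (r : ℕ) (p a : Fin r → ℕ), IsPrimePowerDecomposition G p a := by
  classical
  obtain ⟨ι, _, p, hp, a, ⟨e⟩⟩ := AddCommGroup.equiv_directSum_zmod_of_finite G
  let f := (Fintype.equivFin ι).symm
  refine ⟨Fintype.card ι, p ∘ f, a ∘ f, fun i => hp _, ⟨?_⟩⟩
  exact (e.trans (DirectSum.addEquivProd _)).trans
    { Equiv.piCongrLeft' (fun i => ZMod (p i ^ a i)) (Fintype.equivFin ι) with
      map_add' := fun x y => rfl }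

/-- `k*(G)`: the sum of `1 - 1 / p_i ^ a_i`, where `G` is the direct sum of the cyclic groups of
prime power orders `p_i ^ a_i`. The value does not depend on the decomposition, see
`kStar_eq_sum`. -/
noncomputable def kStar (G : Type*) [AddCommGroup G] [Finite G] : ℝ :=
  let h := exists_isPrimePowerDecomposition G
  let p := h.choose_spec.choose
  let a := h.choose_spec.choose_spec.choose
  ∑ i, (1 - 1 / (p i : ℝ) ^ a i)

theorem card_torsion_of_isPrimePowerDecomposition {G : Type*} [AddCommGroup G] {ι : Type*}
    [Fintype ι] {p a : ι → ℕ} (h : IsPrimePowerDecomposition G p a) {P : ℕ} (hP : P.Prime)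
    (t : ℕ) :
    Nat.card {x : G // P ^ t • x = 0} = P ^ ∑ i, if p i = P then min t (a i) else 0 := by
  classical
  obtain ⟨hp, ⟨e⟩⟩ := h
  have e1 : {x : G // P ^ t • x = 0} ≃ ((i : ι) → {y : ZMod (p i ^ a i) // P ^ t • y = 0}) :=
    (Equiv.subtypeEquiv e.toEquiv (q := fun y => ∀ i, P ^ t • y i = 0) (by
      intro x
      rw [← map_eq_zero_iff e e.injective, map_nsmul, funext_iff]
      rfl)).trans
      (Equiv.subtypePiEquivPi (p := fun i (y : ZMod (p i ^ a i)) => P ^ t • y = 0))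
  rw [Nat.card_congr e1, Nat.card_pi, ← Finset.prod_pow_eq_pow_sum]
  refine Finset.prod_congr rfl fun i _ => ?_
  have : NeZero (p i ^ a i) := ⟨pow_ne_zero _ (hp i).ne_zero⟩
  have hk := IsAddCyclic.card_nsmulAddMonoidHom_ker (G := ZMod (p i ^ a i)) (P ^ t)
  rw [Nat.card_zmod] at hk
  refine Eq.trans ?_ (hk.trans ?_)
  · rfl
  · split_ifs with hi
    · subst hi
      rcases le_total t (a i) with hta | hta
      · rw [min_eq_left hta, Nat.gcd_eq_right (pow_dvd_pow _ hta)]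
      · rw [min_eq_right hta, Nat.gcd_eq_left (pow_dvd_pow _ hta)]
    · rw [pow_zero]
      exact Nat.Coprime.pow _ _ ((Nat.coprime_primes (hp i) hP).2 hi)

theorem one_sub_one_div_pow_eq {P : ℕ} (hP : P.Prime) (a T : ℕ) (h : a ≤ T) :
    (1 - 1 / (P : ℝ) ^ a) = ∑ t ∈ Finset.range T,
      ((P : ℝ) - 1) / (P : ℝ) ^ (t + 1) * (((min (t + 1) a : ℕ) : ℝ) - ((min t a : ℕ) : ℝ)) := by
  have hP0 : (P : ℝ) ≠ 0 := by exact_mod_cast hP.ne_zero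
  induction T, h using Nat.le_induction with
  | base =>
    have : ∀ n ≤ a, (1 - 1 / (P : ℝ) ^ n) = ∑ t ∈ Finset.range n,
      ((P : ℝ) - 1) / (P : ℝ) ^ (t + 1) *
        (((min (t + 1) a : ℕ) : ℝ) - ((min t a : ℕ) : ℝ)) := by
      intro n
      induction n with
      | zero => simp
      | succ n ih =>
        intro hn
        rw [Finset.sum_range_succ, ← ih (by omega), min_eq_left hn, min_eq_left (by omega)]
        push_cast
        field_simp
        ring
    exact this a le_rfl
  | succ T hT ih =>
    rw [Finset.sum_range_succ, ← ih, min_eq_right (by omega), min_eq_right hT]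
    simp

theorem sum_eq_of_isPrimePowerDecomposition {G : Type*} [AddCommGroup G] {ι : Type*} [Fintype ι]
    {p a : ι → ℕ} (h : IsPrimePowerDecomposition G p a) (Q : Finset ℕ) (hQ : ∀ i, p i ∈ Q)
    (hQ' : ∀ P ∈ Q, P.Prime) (T : ℕ) (hT : ∀ i, a i ≤ T) :
    ∑ i, (1 - 1 / (p i : ℝ) ^ a i) = ∑ P ∈ Q, ∑ t ∈ Finset.range T,
      ((P : ℝ) - 1) / (P : ℝ) ^ (t + 1) *
        ((Nat.log P (Nat.card {x : G // P ^ (t + 1) • x = 0}) : ℝ) -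
          (Nat.log P (Nat.card {x : G // P ^ t • x = 0}) : ℝ)) := by
  classical
  have hlog : ∀ P ∈ Q, ∀ t, Nat.log P (Nat.card {x : G // P ^ t • x = 0}) =
      ∑ i, if p i = P then min t (a i) else 0 := by
    intro P hP t
    rw [card_torsion_of_isPrimePowerDecomposition h (hQ' P hP), Nat.log_pow (hQ' P hP).one_lt]
  have hR : ∀ P ∈ Q, ∑ t ∈ Finset.range T,
      ((P : ℝ) - 1) / (P : ℝ) ^ (t + 1) *
        ((Nat.log P (Nat.card {x : G // P ^ (t + 1) • x = 0}) : ℝ) -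
          (Nat.log P (Nat.card {x : G // P ^ t • x = 0}) : ℝ)) =
      ∑ i, if p i = P then (1 - 1 / (p i : ℝ) ^ a i) else 0 := by
    intro P hP
    calc _ = ∑ t ∈ Finset.range T, ∑ i, (if p i = P then ((P : ℝ) - 1) / (P : ℝ) ^ (t + 1) *
          (((min (t + 1) (a i) : ℕ) : ℝ) - ((min t (a i) : ℕ) : ℝ)) else 0) := by
          refine Finset.sum_congr rfl fun t _ => ?_
          rw [hlog P hP, hlog P hP, Nat.cast_sum, Nat.cast_sum, ← Finset.sum_sub_distrib,
            Finset.mul_sum]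
          refine Finset.sum_congr rfl fun i _ => ?_
          split_ifs <;> simp
      _ = _ := by
          rw [Finset.sum_comm]
          refine Finset.sum_congr rfl fun i _ => ?_
          split_ifs with hi
          · rw [hi, one_sub_one_div_pow_eq (hQ' P hP) (a i) T (hT i)]
          · simp
  rw [Finset.sum_congr rfl hR, Finset.sum_comm]
  refine Finset.sum_congr rfl fun i _ => ?_
  rw [Finset.sum_ite_eq, if_pos (hQ i)]

/-- `k*(G)` can be computed from any decomposition of `G` into cyclic groups of prime power
order. -/
theorem kStar_eq_sum {G : Type*} [AddCommGroup G] [Finite G] {ι : Type*} [Fintype ι]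
    {p a : ι → ℕ} (h : IsPrimePowerDecomposition G p a) :
    kStar G = ∑ i, (1 - 1 / (p i : ℝ) ^ a i) := by
  classical
  have h' := (exists_isPrimePowerDecomposition G).choose_spec.choose_spec.choose_spec
  set p' := (exists_isPrimePowerDecomposition G).choose_spec.choose with hp'
  set a' := (exists_isPrimePowerDecomposition G).choose_spec.choose_spec.choose with ha'
  let Q := Finset.univ.image p ∪ Finset.univ.image p'
  let T := (∑ i, a i) + ∑ i, a' i
  have hQ : ∀ P ∈ Q, P.Prime := by
    intro P hP
    rcases Finset.mem_union.1 hP with hP | hP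
    · obtain ⟨i, -, rfl⟩ := Finset.mem_image.1 hP
      exact h.1 i
    · obtain ⟨i, -, rfl⟩ := Finset.mem_image.1 hP
      exact h'.1 i
  have h1 := sum_eq_of_isPrimePowerDecomposition h Q
    (fun i => Finset.mem_union_left _ (Finset.mem_image_of_mem _ (Finset.mem_univ i))) hQ T
    (fun i => (Finset.single_le_sum (f := a) (fun _ _ => Nat.zero_le _)
      (Finset.mem_univ i)).trans (Nat.le_add_right _ _))
  have h2 := sum_eq_of_isPrimePowerDecomposition h' Q
    (fun i => Finset.mem_union_right _ (Finset.mem_image_of_mem _ (Finset.mem_univ i))) hQ T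
    (fun i => (Finset.single_le_sum (f := a') (fun _ _ => Nat.zero_le _)
      (Finset.mem_univ i)).trans (Nat.le_add_left _ _))
  rw [h1, ← h2]
  rfl

/-- A prime `p` is 2-small with respect to `n` if `p ∤ n` and
`(2p + 2) / (2p + 1) > ∑_{d ∣ n} 1 / d`. -/
def IsTwoSmall (p n : ℕ) : Prop :=
  p.Prime ∧ ¬ p ∣ n ∧
    (2 * (p : ℝ) + 2) / (2 * (p : ℝ) + 1) > ∑ d ∈ n.divisors, 1 / (d : ℝ)

end CrossNumber

open CrossNumber

namespace CrossNumber

/-! Put P = C_{p^m} ⊕ C_{p^n}. The lower bounds come from superadditivity of k and from N - 1 copies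
of a generator of C_N; what remains is k(P × G) ≤ k(P) + k(G) and k(P) ≤ k*(P).

Split a zero-sum free sequence over P × G into U, the terms with zero G-component, and V, the rest.
If the subsequence sums of U cover the torsion subgroup P[p^j], no nonempty subsequence of V has its
sum in P[p^j] × 0. If this happens for every j, then k(V) ≤ k(G). Otherwise choose j such that
P[p^j] is covered but some x in P[p^(j+1)] is not. Appending -x to U keeps it zero-sum free, so k(U)
≤ k(P) - p^{-(j+1)}, and k(V) ≤ k(G) + p^{-(j+1)} suffices.

For that bound (`weighted_card_le`, `crossNumber_le_of_free`), sort V by the orders of both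
components. Each quotient P[p^(k+1)]/P[p^k] is elementary of rank at most 2, so a sequence over it
has at most p terms per zero-sum block plus 2(p - 1) more (`exists_disjoint_zero_sums`). Replacing
blocks by their sums lowers the level by one, and at level j the G-components form a zero-sum free
sequence. The leftovers cost at most 2(p - 1)/(d p^{k+1}) for each level k ≥ j and each divisor d >
1 of exp(G), in total at most 2τ/p^j with τ the sum of the 1/d. Being 2-small means τ < 1/(2p + 1),
whence 2τ ≤ 1/p. The same descent with trivial G gives k(P) ≤ k*(P). -/

/-! ### Zero-sum subsequences over elementary `p`-groups -/

theorem exists_le_map_eq_of_le_map {α β : Type*} (f : α → β) (X : Multiset α) :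
    ∀ T : Multiset β, T ≤ X.map f → ∃ T' ≤ X, T'.map f = T := by
  classical
  induction X using Multiset.induction with
  | empty =>
    intro T hT
    exact ⟨0, le_rfl, (Multiset.le_zero.1 hT).symm⟩
  | cons a X ih =>
    intro T hT
    rw [Multiset.map_cons] at hT
    by_cases ha : f a ∈ T
    · obtain ⟨T₀, rfl⟩ := Multiset.exists_cons_of_mem ha
      obtain ⟨T', hT', rfl⟩ := ih T₀ ((Multiset.cons_le_cons_iff _).1 hT)
      exact ⟨a ::ₘ T', Multiset.cons_le_cons _ hT', Multiset.map_cons _ _ _⟩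
    · obtain ⟨T', hT', rfl⟩ := ih T ((Multiset.le_cons_of_notMem ha).1 hT)
      exact ⟨T', hT'.trans (Multiset.le_cons_self _ _), rfl⟩

theorem exists_le_card_eq {α : Type*} (X : Multiset α) (n : ℕ) (hn : n ≤ X.card) :
    ∃ Y ≤ X, Y.card = n := by
  induction X using Quotient.inductionOn with
  | _ l => exact ⟨l.take n, (List.take_sublist n l).subperm, by simpa using hn⟩

/-- The Davenport constant of an elementary `p`-group of rank at most `r` is at most
`r * (p - 1) + 1`. -/
theorem exists_zero_sum_of_finrank_le {p : ℕ} [Fact p.Prime] {V : Type*} [AddCommGroup V]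
    [Module (ZMod p) V] [Module.Finite (ZMod p) V] {r : ℕ}
    (hr : Module.finrank (ZMod p) V ≤ r) {α : Type*} (g : α → V) (X : Multiset α)
    (hX : r * (p - 1) < X.card) : ∃ T ≤ X, T ≠ 0 ∧ (T.map g).sum = 0 := by
  classical
  have hp : p.Prime := Fact.out
  let b := Module.finBasis (ZMod p) V
  -- Chevalley–Warning with one variable per term: since `x ^ (p - 1)` is 0 or 1, the support of a
  -- common zero is a zero-sum subsequence. The trivial zero forces a second one, as `p` divides
  -- their number.
  let f : Fin (Module.finrank (ZMod p) V) → MvPolynomial X.toEnumFinset (ZMod p) := fun j =>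
    ∑ i : X.toEnumFinset, b.repr (g i.1.1) j • MvPolynomial.X i ^ (p - 1)
  have hdeg : (∑ j, (f j).totalDegree) < Fintype.card X.toEnumFinset := by
    calc (∑ j, (f j).totalDegree)
        ≤ ∑ _j : Fin (Module.finrank (ZMod p) V), (p - 1) := by
          refine Finset.sum_le_sum fun j _ => ?_
          refine MvPolynomial.totalDegree_finsetSum_le fun i _ => ?_
          exact (MvPolynomial.totalDegree_smul_le ..).trans
            (MvPolynomial.totalDegree_X_pow ..).le
      _ = Module.finrank (ZMod p) V * (p - 1) := by simp
      _ ≤ r * (p - 1) := Nat.mul_le_mul_right _ hr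
      _ < _ := by simpa using hX
  have hdvd : p ∣ Nat.card {x : X.toEnumFinset → ZMod p // ∀ j, MvPolynomial.eval x (f j) = 0} := by
    rw [Nat.card_eq_fintype_card]
    convert! char_dvd_card_solutions_of_fintype_sum_lt p hdeg
  have hp1 : p - 1 ≠ 0 := by have := hp.two_le; omega
  let z : {x : X.toEnumFinset → ZMod p // ∀ j, MvPolynomial.eval x (f j) = 0} :=
    ⟨0, fun j => by simp [f, hp1]⟩
  have : Nonempty {x : X.toEnumFinset → ZMod p // ∀ j, MvPolynomial.eval x (f j) = 0} := ⟨z⟩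
  have := Finite.one_lt_card_iff_nontrivial.1
    (hp.one_lt.trans_le (Nat.le_of_dvd Nat.card_pos hdvd))
  obtain ⟨x, hx⟩ := exists_ne z
  let t : Finset X.toEnumFinset := {i | x.1 i ≠ 0}
  refine ⟨(t.map (Function.Embedding.subtype _)).1.map Prod.fst,
    Multiset.map_fst_le_of_subset_toEnumFinset ?_, ?_, ?_⟩
  · intro y hy
    obtain ⟨i, -, rfl⟩ := Finset.mem_map.1 hy
    exact i.2
  · rw [← Subtype.coe_ne_coe, Function.ne_iff] at hx
    obtain ⟨i, hi⟩ := hx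
    have hit : i ∈ t := by simpa [t, z] using hi
    intro h0
    have := congrArg Multiset.card h0
    simp only [Multiset.card_map, Multiset.card_zero, Finset.card_val, Finset.card_map] at this
    exact (Finset.card_pos.2 ⟨i, hit⟩).ne' this
  · have h1 : (((t.map (Function.Embedding.subtype _)).1.map Prod.fst).map g).sum =
        ∑ i ∈ t, g i.1.1 := by
      rw [Multiset.map_map, ← Finset.sum_map_val, Finset.sum_map_val]
      exact Finset.sum_map t (Function.Embedding.subtype _) (fun y => g y.1)
    rw [h1]
    apply b.repr.injective
    ext j
    have h2 := x.2 j
    simp only [f, map_sum, MvPolynomial.smul_eval, map_pow, MvPolynomial.eval_X,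
      ZMod.pow_card_sub_one, mul_ite, mul_one, mul_zero] at h2
    rw [map_sum, Finsupp.finsetSum_apply, Finset.sum_filter, map_zero]
    simpa using h2

/-- A long sequence over an elementary `p`-group of rank at most `2` has a zero-sum subsequence of
length at most `p`. -/
theorem exists_short_zero_sum {p : ℕ} [Fact p.Prime] {V : Type*} [AddCommGroup V]
    [Module (ZMod p) V] [Module.Finite (ZMod p) V] {r : ℕ}
    (hr : Module.finrank (ZMod p) V ≤ r) (hr2 : r ≤ 2) {α : Type*} (g : α → V) (X : Multiset α)
    (hX : (r + 1) * (p - 1) < X.card) :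
    ∃ T ≤ X, T ≠ 0 ∧ (T.map g).sum = 0 ∧ T.card ≤ p := by
  classical
  have hp : p.Prime := Fact.out
  have hp2 := hp.two_le
  obtain ⟨Y, hYX, hY⟩ := exists_le_card_eq X ((r + 1) * (p - 1) + 1) hX
  have hrk : Module.finrank (ZMod p) (V × ZMod p) ≤ r + 1 := by
    rw [Module.finrank_prod, Module.finrank_self]
    omega
  -- The extra coordinate 1 makes the length of a zero-sum subsequence divisible by `p`. As `Y` has
  -- at most 3p - 2 terms, only the lengths p and 2p remain.
  obtain ⟨T, hTY, hT0, hT⟩ := exists_zero_sum_of_finrank_le hrk (fun a => (g a, (1 : ZMod p))) Y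
    (by omega)
  have hT1 : (T.map g).sum = 0 := by
    have := congrArg Prod.fst hT
    rw [← AddMonoidHom.coe_fst, map_multiset_sum, Multiset.map_map] at this
    simpa using this
  have hT2 : p ∣ T.card := by
    have := congrArg Prod.snd hT
    rw [← AddMonoidHom.coe_snd, map_multiset_sum, Multiset.map_map] at this
    simpa [ZMod.natCast_eq_zero_iff] using this
  have hTle : T.card ≤ 3 * (p - 1) + 1 := by
    refine (Multiset.card_le_card hTY).trans (hY.le.trans ?_)
    have : (r + 1) * (p - 1) ≤ 3 * (p - 1) := Nat.mul_le_mul_right _ (by omega)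
    omega
  by_cases hle : T.card ≤ p
  · exact ⟨T, hTY.trans hYX, hT0, hT1, hle⟩
  have hTc : T.card = 2 * p := by
    obtain ⟨k, hk⟩ := hT2
    have h1 : 1 < k := by
      by_contra h
      have : p * k ≤ p * 1 := Nat.mul_le_mul_left _ (by omega)
      omega
    have h2 : k < 3 := by
      by_contra h
      have : p * 3 ≤ p * k := Nat.mul_le_mul_left _ (by omega)
      omega
    have : k = 2 := by omega
    rw [hk, this, mul_comm]
  -- Deleting one term forces the zero-sum subsequence found next to be proper. It and its
  -- complement in `T` are then both nonempty with sum zero, and one of them has length at most p.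
  obtain ⟨a, ha⟩ := Multiset.exists_mem_of_ne_zero hT0
  have hce : (T.erase a).card = 2 * p - 1 := by
    rw [Multiset.card_erase_of_mem ha, hTc]; rfl
  obtain ⟨U, hUT, hU0, hU⟩ := exists_zero_sum_of_finrank_le hr g (T.erase a) (by
    have : r * (p - 1) ≤ 2 * (p - 1) := Nat.mul_le_mul_right _ hr2
    omega)
  have hUT' : U ≤ T := hUT.trans (Multiset.erase_le _ _)
  have hUc := Multiset.card_le_card hUT
  obtain ⟨W, rfl⟩ := Multiset.le_iff_exists_add.1 hUT'
  rw [Multiset.card_add] at hTc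
  by_cases hUp : U.card ≤ p
  · exact ⟨U, hUT'.trans (hTY.trans hYX), hU0, hU, hUp⟩
  · refine ⟨W, (Multiset.le_add_left _ _).trans (hTY.trans hYX), ?_, ?_, by omega⟩
    · rintro rfl
      simp at hTc
      omega
    · simpa [hU] using hT1

/-- A sequence over an elementary `p`-group of rank `r ≤ 2` contains many disjoint zero-sum
subsequences. -/
theorem exists_disjoint_zero_sums {p : ℕ} [Fact p.Prime] {V : Type*} [AddCommGroup V]
    [Module (ZMod p) V] [Module.Finite (ZMod p) V] {r : ℕ}
    (hr : Module.finrank (ZMod p) V ≤ r) (hr2 : r ≤ 2) {α : Type*} (g : α → V) (X : Multiset α) :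
    ∃ B : Multiset (Multiset α), B.sum ≤ X ∧ (∀ T ∈ B, T ≠ 0 ∧ (T.map g).sum = 0) ∧
      X.card ≤ p * B.card + r * (p - 1) := by
  classical
  have hp2 := (Fact.out : p.Prime).two_le
  induction hn : X.card using Nat.strong_induction_on generalizing X with
  | _ n ih =>
  subst hn
  by_cases h1 : X.card ≤ r * (p - 1)
  · exact ⟨0, by simp, by simp, by simpa using h1⟩
  -- In this range a single block of any length is enough, because (r + 1)(p - 1) ≤ p + r(p - 1).
  by_cases h2 : X.card ≤ (r + 1) * (p - 1)
  · obtain ⟨T, hT, hT0, hTs⟩ := exists_zero_sum_of_finrank_le hr g X (by omega)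
    refine ⟨{T}, by simpa using hT, by simpa using ⟨hT0, hTs⟩, ?_⟩
    rw [Multiset.card_singleton]
    rw [add_mul] at h2
    omega
  · obtain ⟨T, hT, hT0, hTs, hTp⟩ := exists_short_zero_sum hr hr2 g X (by omega)
    obtain ⟨Y, rfl⟩ := Multiset.le_iff_exists_add.1 hT
    have hTc := Multiset.card_pos.2 hT0
    rw [Multiset.card_add] at ih ⊢
    obtain ⟨B, hB, hB', hBc⟩ := ih Y.card (by omega) Y rfl
    refine ⟨T ::ₘ B, ?_, ?_, ?_⟩
    · rw [Multiset.sum_cons]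
      exact add_le_add_right hB T
    · intro U hU
      rcases Multiset.mem_cons.1 hU with rfl | hU
      · exact ⟨hT0, hTs⟩
      · exact hB' U hU
    · rw [Multiset.card_cons, mul_add]
      omega

/-! ### Blocks, their sums, and torsion layers -/

theorem exists_add_eq_of_le_add {α : Type*} {A B T : Multiset α} (hT : T ≤ A + B) :
    ∃ T₁ ≤ A, ∃ T₂ ≤ B, T₁ + T₂ = T := by
  classical
  refine ⟨T ∩ A, Multiset.inter_le_right, T - T ∩ A, ?_,
    add_tsub_cancel_of_le Multiset.inter_le_left⟩
  rw [Multiset.le_iff_count] at hT ⊢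
  intro a
  have := hT a
  simp only [Multiset.count_add, Multiset.count_sub, Multiset.count_inter] at this ⊢
  omega

/-- Replacing disjoint nonempty subsequences by their sums preserves the property that nonempty
subsequences have no sum in a given set. -/
theorem forall_le_add_map_sum {H : Type*} [AddCommMonoid H] {q : H → Prop} {A X : Multiset H}
    (h : ∀ T ≤ A + X, q T.sum → T = 0) {B : Multiset (Multiset H)} (hB : B.sum ≤ X)
    (hB0 : ∀ T ∈ B, T ≠ 0) : ∀ T ≤ A + B.map Multiset.sum, q T.sum → T = 0 := by
  classical
  intro T hT hq
  obtain ⟨T₁, h₁, T₂, h₂, rfl⟩ := exists_add_eq_of_le_add hT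
  obtain ⟨C, hC, rfl⟩ := exists_le_map_eq_of_le_map _ _ _ h₂
  have hCs : C.sum ≤ X := by
    obtain ⟨C', rfl⟩ := Multiset.le_iff_exists_add.1 hC
    rw [Multiset.sum_add] at hB
    exact (Multiset.le_add_right _ _).trans hB
  have hss : C.sum.sum = (C.map Multiset.sum).sum := by
    exact map_multiset_sum Multiset.sumAddMonoidHom C
  have h0 := h (T₁ + C.sum) (add_le_add h₁ hCs) (by rwa [Multiset.sum_add, hss, ← Multiset.sum_add])
  rw [add_eq_zero] at h0
  obtain rfl : C = 0 := by
    refine Multiset.eq_zero_of_forall_notMem fun T hT => hB0 T (Multiset.mem_of_le hC hT) ?_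
    exact Multiset.le_zero.1 (h0.2 ▸ Multiset.single_le_sum (fun _ _ => Multiset.zero_le _) T hT)
  simp [h0.1]

/-- The elements of order dividing `p` in `p ^ k • P`; multiplication by `p ^ k` identifies the
quotient of the `p ^ (k + 1)`-torsion by the `p ^ k`-torsion with this group. -/
def torsionLayer (P : Type*) [AddCommGroup P] (p k : ℕ) : AddSubgroup P :=
  (nsmulAddMonoidHom p : P →+ P).ker ⊓ (nsmulAddMonoidHom (p ^ k) : P →+ P).range

theorem mem_torsionLayer {P : Type*} [AddCommGroup P] {p k : ℕ} {x : P} :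
    x ∈ torsionLayer P p k ↔ p • x = 0 ∧ ∃ y, p ^ k • y = x := by
  simp [torsionLayer, AddSubgroup.mem_inf, AddMonoidHom.mem_ker]

/-- Multiplication by `p ^ k` sends the `P`-components into the layer, a vector space over `ZMod p`
of dimension at most `r`; a block has sum zero there exactly when its sum is killed by `p ^ k`. -/
theorem exists_disjoint_torsion_sums {p : ℕ} [Fact p.Prime] {P G : Type*} [AddCommGroup P]
    [Finite P] [AddCommGroup G] {k r : ℕ} (hr2 : r ≤ 2)
    (hr : Nat.card (torsionLayer P p k) ≤ p ^ r) (X : Multiset (P × G))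
    (hX : ∀ h ∈ X, p ^ (k + 1) • h.1 = 0) :
    ∃ B : Multiset (Multiset (P × G)), B.sum ≤ X ∧ (∀ T ∈ B, T ≠ 0 ∧ p ^ k • T.sum.1 = 0) ∧
      X.card ≤ p * B.card + r * (p - 1) := by
  classical
  let V := torsionLayer P p k
  let instModule : Module (ZMod p) V := AddCommGroup.zmodModule fun x => by
    ext
    simpa using (mem_torsionLayer.1 x.2).1
  have instFinite : Module.Finite (ZMod p) V := Module.Finite.of_finite
  have hfr : Module.finrank (ZMod p) V ≤ r := by
    have h1 : Nat.card V = p ^ Module.finrank (ZMod p) V :=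
      (FiniteField.pow_finrank_eq_natCard p V).symm
    exact (Nat.pow_le_pow_iff_right (Fact.out : p.Prime).one_lt).1 (h1 ▸ hr)
  -- The default 0 is never taken on terms of `X`, by `hX`.
  let g : P × G → V := fun h =>
    if hh : p ^ k • h.1 ∈ V then ⟨p ^ k • h.1, hh⟩ else 0
  obtain ⟨B, hB, hB', hc⟩ :=
    @exists_disjoint_zero_sums p _ V _ instModule instFinite r hfr hr2 _ g X
  refine ⟨B, hB, fun T hT => ⟨(hB' T hT).1, ?_⟩, hc⟩
  have hTX : T ≤ X := (Multiset.single_le_sum (fun _ _ => Multiset.zero_le _) T hT).trans hB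
  have h0 := congrArg V.subtype (hB' T hT).2
  rw [map_multiset_sum, Multiset.map_map, map_zero] at h0
  have h1 : T.map (V.subtype ∘ g) =
      T.map ((nsmulAddMonoidHom (p ^ k)).comp (AddMonoidHom.fst P G)) := by
    refine Multiset.map_congr rfl fun h hh => ?_
    have hm : p ^ k • h.1 ∈ V := mem_torsionLayer.2
      ⟨by rw [smul_smul, ← pow_succ']; exact hX h (Multiset.mem_of_le hTX hh), _, rfl⟩
    simp [g, hm]
  rw [h1, ← map_multiset_sum] at h0
  simpa using h0

/-! ### Weighted counting along the torsion filtration -/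

/-- A zero-sum free sequence has cross number at most `k(G)`. -/
theorem ZeroSumFree.crossNumber_le {G : Type*} [AddCommGroup G] [Finite G] {S : Multiset G}
    (hS : ZeroSumFree S) : crossNumber S ≤ littleCrossNumber G :=
  (littleCrossNumber_isGreatest G).2 ⟨S, hS, rfl⟩

theorem crossNumber_zero {G : Type*} [AddCommGroup G] : crossNumber (0 : Multiset G) = 0 := by
  simp [crossNumber]

theorem crossNumber_cons {G : Type*} [AddCommGroup G] (a : G) (S : Multiset G) :
    crossNumber (a ::ₘ S) = 1 / (addOrderOf a : ℝ) + crossNumber S := by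
  simp [crossNumber]

theorem crossNumber_add {G : Type*} [AddCommGroup G] (S T : Multiset G) :
    crossNumber (S + T) = crossNumber S + crossNumber T := by
  simp [crossNumber]

theorem crossNumber_sum {G : Type*} [AddCommGroup G] {ι : Type*} (s : Finset ι)
    (S : ι → Multiset G) : crossNumber (∑ i ∈ s, S i) = ∑ i ∈ s, crossNumber (S i) := by
  classical
  induction s using Finset.induction_on with
  | empty => simp [crossNumber_zero]
  | insert a s ha ih => rw [Finset.sum_insert ha, Finset.sum_insert ha, crossNumber_add, ih]

theorem card_mul_le_crossNumber {G : Type*} [AddCommGroup G] (S : Multiset G) (c : ℝ)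
    (h : ∀ g ∈ S, c ≤ 1 / (addOrderOf g : ℝ)) : S.card * c ≤ crossNumber S := by
  induction S using Multiset.induction with
  | empty => simp [crossNumber_zero]
  | cons a S ih =>
    rw [crossNumber_cons, Multiset.card_cons]
    have h1 := h a (Multiset.mem_cons_self a S)
    have h2 := ih fun g hg => h g (Multiset.mem_cons_of_mem hg)
    push_cast
    linarith

theorem crossNumber_le_card_mul {G : Type*} [AddCommGroup G] (S : Multiset G) (c : ℝ)
    (h : ∀ g ∈ S, 1 / (addOrderOf g : ℝ) ≤ c) : crossNumber S ≤ S.card * c := by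
  induction S using Multiset.induction with
  | empty => simp [crossNumber_zero]
  | cons a S ih =>
    rw [crossNumber_cons, Multiset.card_cons]
    have h1 := h a (Multiset.mem_cons_self a S)
    have h2 := ih fun g hg => h g (Multiset.mem_cons_of_mem hg)
    push_cast
    linarith

/-- Let `M i d` consist of elements whose components are killed by `p ^ (j + i)` and `d`. If no
nonempty subsequence of the union has its sum in the `p ^ j`-torsion of `P`, the weighted length
of the union is bounded, for weights decreasing by a factor of at least `p` at each level. -/
theorem weighted_card_le {p : ℕ} [Fact p.Prime] {P G : Type*} [AddCommGroup P] [Finite P]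
    [AddCommGroup G] [Finite G] (j : ℕ) (r : ℕ → ℕ) (hr2 : ∀ k, r k ≤ 2)
    (hr : ∀ k, Nat.card (torsionLayer P p k) ≤ p ^ r k) (D : Finset ℕ) (hD : ∀ d ∈ D, 0 < d)
    (c : ℕ → ℝ) (hc0 : c 0 = 1) (hc : ∀ i, 0 ≤ c i) (hcp : ∀ i, p * c (i + 1) ≤ c i) (k : ℕ) :
    ∀ M : ℕ → ℕ → Multiset (P × G),
      (∀ i d, ∀ h ∈ M i d, p ^ (j + i) • h.1 = 0 ∧ d • h.2 = 0) →
      (∀ T ≤ ∑ i ∈ Finset.range (k + 1), ∑ d ∈ D, M i d,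
        (p ^ j • T.sum.1 = 0 ∧ T.sum.2 = 0) → T = 0) →
      ∑ i ∈ Finset.range (k + 1), c i * ∑ d ∈ D, ((M i d).card : ℝ) * (1 / (d : ℝ)) ≤
        littleCrossNumber G + ∑ i ∈ Finset.range k, c (i + 1) *
          (r (j + i) * ((p : ℝ) - 1) * ∑ d ∈ D, 1 / (d : ℝ)) := by
  classical
  have hp1 : 1 ≤ p := (Fact.out : p.Prime).one_lt.le
  induction k with
  | zero =>
    intro M hM hfree
    simp only [zero_add, Finset.sum_range_one, hc0, one_mul, Finset.sum_range_zero, add_zero]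
      at hfree ⊢
    -- Every `P`-component is now killed by `p ^ j`, so the condition on `P` in `hfree` is
    -- automatic.
    have hz : ZeroSumFree ((∑ d ∈ D, M 0 d).map Prod.snd) := by
      intro T hT hT0
      obtain ⟨T', hT', rfl⟩ := exists_le_map_eq_of_le_map _ _ _ hT
      have h2 : T'.sum.2 = 0 := by
        rw [← hT0]
        exact map_multiset_sum (AddMonoidHom.snd P G) T'
      have h1 : p ^ j • T'.sum.1 = 0 := by
        have : T'.sum.1 = (T'.map Prod.fst).sum := map_multiset_sum (AddMonoidHom.fst P G) T'
        rw [this, ← Multiset.sum_map_nsmul]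
        refine Multiset.sum_eq_zero fun x hx => ?_
        obtain ⟨h, hh, rfl⟩ := Multiset.mem_map.1 hx
        obtain ⟨d, hd, hhd⟩ := Multiset.mem_sum.1 (Multiset.mem_of_le hT' hh)
        simpa using (hM 0 d h hhd).1
      rw [hfree T' hT' ⟨h1, h2⟩, Multiset.map_zero]
    refine le_trans ?_ hz.crossNumber_le
    rw [← Multiset.coe_mapAddMonoidHom, map_sum, crossNumber_sum]
    refine Finset.sum_le_sum fun d hd => ?_
    rw [Multiset.coe_mapAddMonoidHom, ← Multiset.card_map Prod.snd (M 0 d)]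
    refine card_mul_le_crossNumber _ _ fun g hg => ?_
    obtain ⟨h, hh, rfl⟩ := Multiset.mem_map.1 hg
    have hdvd := addOrderOf_dvd_of_nsmul_eq_zero (hM 0 d h hh).2
    exact one_div_le_one_div_of_le (by exact_mod_cast addOrderOf_pos h.2)
      (by exact_mod_cast Nat.le_of_dvd (hD d hd) hdvd)
  | succ k ih =>
    intro M hM hfree
    -- Blocks are formed separately for each `d`, so that their sums are still killed by `d` in `G`;
    -- they join level `k`.
    have hB := fun d => exists_disjoint_torsion_sums (hr2 (j + k)) (hr (j + k)) (M (k + 1) d)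
      (fun h hh => (hM (k + 1) d h hh).1)
    choose B hBM hB hBc using hB
    let M' : ℕ → ℕ → Multiset (P × G) := fun i d =>
      if i = k then M i d + (B d).map Multiset.sum else M i d
    have hsum : ∑ i ∈ Finset.range (k + 1), ∑ d ∈ D, M' i d =
        (∑ i ∈ Finset.range (k + 1), ∑ d ∈ D, M i d) + (∑ d ∈ D, B d).map Multiset.sum := by
      rw [Finset.sum_range_succ, Finset.sum_range_succ, ← Multiset.coe_mapAddMonoidHom, map_sum,
        add_assoc, ← Finset.sum_add_distrib]
      congr 1
      · refine Finset.sum_congr rfl fun i hi => ?_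
        simp [M', (Finset.mem_range.1 hi).ne]
      · simp [M']
    have hBs : (∑ d ∈ D, B d).sum ≤ ∑ d ∈ D, M (k + 1) d := by
      rw [← Multiset.coe_sumAddMonoidHom, map_sum]
      exact Finset.sum_le_sum fun d _ => hBM d
    rw [Finset.sum_range_succ] at hfree
    have hfree' := forall_le_add_map_sum (q := fun x => p ^ j • x.1 = 0 ∧ x.2 = 0) hfree hBs
      (fun T hT => by
        obtain ⟨d, -, hTd⟩ := Multiset.mem_sum.1 hT
        exact (hB d T hTd).1)
    rw [← hsum] at hfree'
    have hM' : ∀ i d, ∀ h ∈ M' i d, p ^ (j + i) • h.1 = 0 ∧ d • h.2 = 0 := by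
      intro i d h hh
      by_cases hi : i = k
      · subst hi
        simp only [M', if_true, Multiset.mem_add, Multiset.mem_map] at hh
        rcases hh with hh | ⟨T, hT, rfl⟩
        · exact hM i d h hh
        · refine ⟨(hB d T hT).2, ?_⟩
          have hTM : T ≤ M (i + 1) d :=
            (Multiset.single_le_sum (fun _ _ => Multiset.zero_le _) T hT).trans (hBM d)
          have : T.sum.2 = (T.map Prod.snd).sum := map_multiset_sum (AddMonoidHom.snd P G) T
          rw [this, ← Multiset.sum_map_nsmul]
          refine Multiset.sum_eq_zero fun x hx => ?_
          obtain ⟨h, hh, rfl⟩ := Multiset.mem_map.1 hx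
          exact (hM (i + 1) d h (Multiset.mem_of_le hTM hh)).2
      · simp only [M', if_neg hi] at hh
        exact hM i d h hh
    have key := ih M' hM' hfree'
    have hcard : ∑ i ∈ Finset.range (k + 1), c i * ∑ d ∈ D, ((M' i d).card : ℝ) * (1 / (d : ℝ)) =
        ∑ i ∈ Finset.range (k + 1), c i * ∑ d ∈ D, ((M i d).card : ℝ) * (1 / (d : ℝ)) +
          c k * ∑ d ∈ D, ((B d).card : ℝ) * (1 / (d : ℝ)) := by
      rw [Finset.sum_range_succ, Finset.sum_range_succ, add_assoc, ← mul_add,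
        ← Finset.sum_add_distrib]
      congr 1
      · refine Finset.sum_congr rfl fun i hi => ?_
        simp [M', (Finset.mem_range.1 hi).ne]
      · congr 1
        refine Finset.sum_congr rfl fun d _ => ?_
        simp only [M', if_true, Multiset.card_add, Multiset.card_map]
        push_cast
        ring
    have hlast : c (k + 1) * ∑ d ∈ D, ((M (k + 1) d).card : ℝ) * (1 / (d : ℝ)) ≤
        c k * ∑ d ∈ D, ((B d).card : ℝ) * (1 / (d : ℝ)) +
          c (k + 1) * (r (j + k) * ((p : ℝ) - 1) * ∑ d ∈ D, 1 / (d : ℝ)) := by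
      calc _ ≤ c (k + 1) * ∑ d ∈ D, ((p : ℝ) * (B d).card + r (j + k) * ((p : ℝ) - 1)) *
              (1 / (d : ℝ)) := by
            refine mul_le_mul_of_nonneg_left (Finset.sum_le_sum fun d _ => ?_) (hc _)
            refine mul_le_mul_of_nonneg_right ?_ (by positivity)
            have : (((M (k + 1) d).card : ℕ) : ℝ) ≤
                ((p * (B d).card + r (j + k) * (p - 1) : ℕ) : ℝ) := by exact_mod_cast hBc d
            rw [Nat.cast_add, Nat.cast_mul, Nat.cast_mul, Nat.cast_sub hp1, Nat.cast_one] at this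
            exact this
        _ = (p * c (k + 1)) * ∑ d ∈ D, ((B d).card : ℝ) * (1 / (d : ℝ)) +
            c (k + 1) * (r (j + k) * ((p : ℝ) - 1) * ∑ d ∈ D, 1 / (d : ℝ)) := by
            rw [Finset.mul_sum, Finset.mul_sum, Finset.mul_sum, Finset.mul_sum,
              ← Finset.sum_add_distrib]
            exact Finset.sum_congr rfl fun d _ => by ring
        _ ≤ _ := by
            gcongr
            exact hcp k
    rw [Finset.sum_range_succ _ (k + 1)]
    conv_rhs => rw [Finset.sum_range_succ]
    linarith

theorem sum_filter_eq_self {α β : Type*} [DecidableEq β] (f : α → β) (s : Finset β)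
    (X : Multiset α) (h : ∀ x ∈ X, f x ∈ s) : ∑ b ∈ s, X.filter (fun x => f x = b) = X := by
  classical
  ext x
  rw [Multiset.count_sum']
  simp only [Multiset.count_filter]
  rw [Finset.sum_ite_eq]
  split_ifs with hx
  · rfl
  · exact (Multiset.count_eq_zero_of_notMem fun hxX => hx (h x hxX)).symm

/-- A sequence over `P × G` without nonempty subsequence whose sum lies in the `p ^ j`-torsion of
`P` has bounded cross number. -/
theorem crossNumber_le_of_free {p : ℕ} [Fact p.Prime] {P G : Type*} [AddCommGroup P] [Finite P]
    [AddCommGroup G] [Finite G] (j l : ℕ) (r : ℕ → ℕ) (hr2 : ∀ k, r k ≤ 2)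
    (hr : ∀ k, Nat.card (torsionLayer P p k) ≤ p ^ r k) (hP : ∀ x : P, p ^ (j + l) • x = 0)
    (D : Finset ℕ) (V : Multiset (P × G)) (hVD : ∀ h ∈ V, addOrderOf h.2 ∈ D)
    (hpD : ∀ d ∈ D, 0 < d ∧ ¬ p ∣ d)
    (hV : ∀ T ≤ V, (p ^ j • T.sum.1 = 0 ∧ T.sum.2 = 0) → T = 0) :
    crossNumber V ≤ littleCrossNumber G + ∑ i ∈ Finset.range l, 1 / (p : ℝ) ^ (j + (i + 1)) *
      (r (j + i) * ((p : ℝ) - 1) * ∑ d ∈ D, 1 / (d : ℝ)) := by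
  classical
  have hp : p.Prime := Fact.out
  have hp1 : (1 : ℝ) ≤ p := by exact_mod_cast hp.one_lt.le
  have hlev : ∀ x : P, ∃ a ≤ j + l, addOrderOf x = p ^ a := fun x =>
    (Nat.dvd_prime_pow hp).1 (addOrderOf_dvd_of_nsmul_eq_zero (hP x))
  choose a ha hao using hlev
  -- Level 0 collects all terms whose `P`-component has order at most `p ^ j` (truncated subtraction
  -- in `M`). Its weight is 1, not `1 / p ^ j`, since at the bottom only the order in `G` counts;
  -- this only enlarges the left side.
  let c : ℕ → ℝ := fun i => if i = 0 then 1 else 1 / (p : ℝ) ^ (j + i)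
  let M : ℕ → ℕ → Multiset (P × G) := fun i d =>
    (V.filter fun h => a h.1 - j = i).filter fun h => addOrderOf h.2 = d
  have hVM : ∑ i ∈ Finset.range (l + 1), ∑ d ∈ D, M i d = V := by
    calc _ = ∑ i ∈ Finset.range (l + 1), V.filter fun h => a h.1 - j = i := by
          refine Finset.sum_congr rfl fun i _ => ?_
          exact sum_filter_eq_self _ _ _ fun h hh => hVD h (Multiset.mem_filter.1 hh).1
      _ = V := sum_filter_eq_self (fun h : P × G => a h.1 - j) _ _ fun h _ => by
          have := ha h.1
          rw [Finset.mem_range]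
          omega
  have hmain := weighted_card_le (p := p) (P := P) (G := G) j r hr2 hr D (fun d hd => (hpD d hd).1)
    c (by simp [c]) (fun i => by simp only [c]; split_ifs <;> positivity) (fun i => by
      simp only [c, Nat.add_eq_zero_iff, one_ne_zero, and_false, if_false]
      split_ifs with hi
      · subst hi
        rw [zero_add, pow_succ, mul_one_div, div_mul_cancel_right₀ (by positivity)]
        exact inv_le_one_of_one_le₀ (one_le_pow₀ hp1)
      · rw [← add_assoc, pow_succ, mul_one_div, div_mul_cancel_right₀ (by positivity), one_div])
    l M (by
      intro i d h hh
      obtain ⟨hh, hd⟩ := Multiset.mem_filter.1 hh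
      obtain ⟨-, hi⟩ := Multiset.mem_filter.1 hh
      refine ⟨?_, hd ▸ addOrderOf_nsmul_eq_zero _⟩
      rw [← addOrderOf_dvd_iff_nsmul_eq_zero, hao]
      exact pow_dvd_pow _ (by omega)) (by rwa [hVM])
  refine le_trans ?_ hmain
  · conv_lhs => rw [← hVM]
    rw [crossNumber_sum]
    refine Finset.sum_le_sum fun i _ => ?_
    rw [crossNumber_sum, Finset.mul_sum]
    refine Finset.sum_le_sum fun d hd => ?_
    rw [mul_left_comm]
    refine crossNumber_le_card_mul _ _ fun h hh => ?_
    obtain ⟨hh, hd'⟩ := Multiset.mem_filter.1 hh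
    obtain ⟨-, hi⟩ := Multiset.mem_filter.1 hh
    have hcop : Nat.Coprime (addOrderOf h.1) (addOrderOf h.2) := by
      rw [hao, hd']
      exact Nat.Coprime.pow_left _ ((Nat.Prime.coprime_iff_not_dvd hp).2 (hpD d hd).2)
    rw [Prod.addOrderOf, hcop.lcm_eq_mul, hd', hao, Nat.cast_mul, ← one_div_mul_one_div,
      Nat.cast_pow]
    refine mul_le_mul_of_nonneg_right ?_ (by positivity)
    simp only [c]
    split_ifs with hi0
    · rw [one_div]
      exact inv_le_one_of_one_le₀ (one_le_pow₀ hp1)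
    · rw [show a h.1 = j + i by omega]

/-! ### Transport along homomorphisms and superadditivity -/

theorem ZeroSumFree.mono {G : Type*} [AddCommGroup G] {S T : Multiset G} (hS : ZeroSumFree S)
    (h : T ≤ S) : ZeroSumFree T :=
  fun U hU hU0 => hS U (hU.trans h) hU0

theorem zeroSumFree_map_iff {G H : Type*} [AddCommGroup G] [AddCommGroup H] (f : G →+ H)
    (hf : Function.Injective f) {S : Multiset G} : ZeroSumFree (S.map f) ↔ ZeroSumFree S := by
  constructor
  · intro h T hT hT0
    have := h (T.map f) (Multiset.map_le_map hT) (by rw [← map_multiset_sum, hT0, map_zero])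
    exact Multiset.map_eq_zero.1 this
  · intro h T hT hT0
    obtain ⟨T', hT', rfl⟩ := exists_le_map_eq_of_le_map _ _ _ hT
    rw [← map_multiset_sum, map_eq_zero_iff f hf] at hT0
    rw [h T' hT' hT0, Multiset.map_zero]

theorem crossNumber_map {G H : Type*} [AddCommGroup G] [AddCommGroup H] (f : G →+ H)
    (hf : Function.Injective f) (S : Multiset G) : crossNumber (S.map f) = crossNumber S := by
  simp [crossNumber, Multiset.map_map, addOrderOf_injective f hf]

theorem littleCrossNumber_le {G : Type*} [AddCommGroup G] [Finite G] {x : ℝ}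
    (h : ∀ S : Multiset G, ZeroSumFree S → crossNumber S ≤ x) : littleCrossNumber G ≤ x := by
  obtain ⟨S, hS, hSx⟩ := (littleCrossNumber_isGreatest G).1
  exact hSx ▸ h S hS

theorem exists_crossNumber_eq (G : Type*) [AddCommGroup G] [Finite G] :
    ∃ S : Multiset G, ZeroSumFree S ∧ crossNumber S = littleCrossNumber G :=
  (littleCrossNumber_isGreatest G).1

theorem littleCrossNumber_congr {G H : Type*} [AddCommGroup G] [Finite G] [AddCommGroup H]
    [Finite H] (e : G ≃+ H) : littleCrossNumber G = littleCrossNumber H := by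
  refine le_antisymm (littleCrossNumber_le fun S hS => ?_) (littleCrossNumber_le fun S hS => ?_)
  · rw [← crossNumber_map e.toAddMonoidHom e.injective]
    exact ((zeroSumFree_map_iff e.toAddMonoidHom e.injective).2 hS).crossNumber_le
  · rw [← crossNumber_map e.symm.toAddMonoidHom e.symm.injective]
    exact ((zeroSumFree_map_iff e.symm.toAddMonoidHom e.symm.injective).2 hS).crossNumber_le

/-- Optimal sequences of the two factors, joined in the product, stay zero-sum free: a zero sum
vanishes in each coordinate. -/
theorem add_le_littleCrossNumber_prod (G H : Type*) [AddCommGroup G] [Finite G] [AddCommGroup H]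
    [Finite H] : littleCrossNumber G + littleCrossNumber H ≤ littleCrossNumber (G × H) := by
  obtain ⟨S, hS, hSx⟩ := exists_crossNumber_eq G
  obtain ⟨T, hT, hTx⟩ := exists_crossNumber_eq H
  have hl : Function.Injective (AddMonoidHom.inl G H) := fun x y h => congrArg Prod.fst h
  have hr : Function.Injective (AddMonoidHom.inr G H) := fun x y h => congrArg Prod.snd h
  rw [← hSx, ← hTx, ← crossNumber_map _ hl, ← crossNumber_map _ hr, ← crossNumber_add]
  refine ZeroSumFree.crossNumber_le ?_
  intro U hU hU0
  obtain ⟨U₁, h₁, U₂, h₂, rfl⟩ := exists_add_eq_of_le_add hU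
  obtain ⟨S', hS', rfl⟩ := exists_le_map_eq_of_le_map _ _ _ h₁
  obtain ⟨T', hT', rfl⟩ := exists_le_map_eq_of_le_map _ _ _ h₂
  rw [Multiset.sum_add, ← map_multiset_sum, ← map_multiset_sum] at hU0
  have h1 : S'.sum = 0 := by simpa using congrArg Prod.fst hU0
  have h2 : T'.sum = 0 := by simpa using congrArg Prod.snd hU0
  rw [hS S' hS' h1, hT T' hT' h2]
  simp

theorem sum_one_div_pow {p : ℕ} (hp : 1 < p) (l : ℕ) :
    ∑ i ∈ Finset.range l, 1 / (p : ℝ) ^ (i + 1) * ((p : ℝ) - 1) = 1 - 1 / (p : ℝ) ^ l := by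
  have : (p : ℝ) ≠ 0 := by positivity
  induction l with
  | zero => simp
  | succ l ih =>
    rw [Finset.sum_range_succ, ih]
    field_simp
    ring

theorem littleCrossNumber_punit : littleCrossNumber PUnit.{1} = 0 := by
  obtain ⟨S, hS, hSx⟩ := exists_crossNumber_eq PUnit.{1}
  rw [hS S le_rfl rfl, crossNumber_zero] at hSx
  exact hSx.symm

/-! ### Upper bounds for `P` and `P × G` -/

/-- The bound for the little cross number of a finite abelian `p`-group of rank at most `2`. -/
theorem littleCrossNumber_le_of_torsionLayer {p : ℕ} [Fact p.Prime] {P : Type*} [AddCommGroup P]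
    [Finite P] (l : ℕ) (r : ℕ → ℕ) (hr2 : ∀ k, r k ≤ 2)
    (hr : ∀ k, Nat.card (torsionLayer P p k) ≤ p ^ r k) (hP : ∀ x : P, p ^ l • x = 0) :
    littleCrossNumber P ≤
      ∑ i ∈ Finset.range l, 1 / (p : ℝ) ^ (i + 1) * (r i * ((p : ℝ) - 1)) := by
  refine littleCrossNumber_le fun S hS => ?_
  have hl : Function.Injective (AddMonoidHom.inl P PUnit.{1}) := fun x y h => congrArg Prod.fst h
  have hp : p.Prime := Fact.out
  -- With trivial `G` and `j = 0` the hypothesis is plain zero-sum freeness, and 1 is the only order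
  -- in `G`.
  have h := crossNumber_le_of_free (G := PUnit.{1}) 0 l r hr2 hr (by simpa using hP) {1}
    (S.map (AddMonoidHom.inl P PUnit.{1})) (fun h _ => by simp)
    (by simpa using hp.one_lt.ne') (fun T hT hT0 =>
      (zeroSumFree_map_iff _ hl).2 hS T hT (Prod.ext (by simpa using hT0.1) hT0.2))
  rw [crossNumber_map _ hl, littleCrossNumber_punit] at h
  simpa using h

/-- If `p` is 2-small with respect to the exponent of `G`, and `P` is a finite abelian `p`-group of
rank at most `2`, then `k(P × G) ≤ k(P) + k(G)`. -/
theorem littleCrossNumber_prod_le {p : ℕ} [Fact p.Prime] {P G : Type*} [AddCommGroup P] [Finite P]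
    [AddCommGroup G] [Finite G] (l : ℕ) (hP : ∀ x : P, p ^ l • x = 0)
    (hr : ∀ k, Nat.card (torsionLayer P p k) ≤ p ^ 2)
    (hp : IsTwoSmall p (AddMonoid.exponent G)) :
    littleCrossNumber (P × G) ≤ littleCrossNumber P + littleCrossNumber G := by
  classical
  obtain ⟨hpp, hpN, hsmall⟩ := hp
  have hp0 : (0 : ℝ) < p := by exact_mod_cast hpp.pos
  have hN0 : AddMonoid.exponent G ≠ 0 := AddMonoid.exponent_ne_zero_of_finite
  refine littleCrossNumber_le fun S hS => ?_
  have hl : Function.Injective (AddMonoidHom.inl P G) := fun x y h => congrArg Prod.fst h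
  let U := S.filter fun h => h.2 = 0
  let V := S.filter fun h => ¬ h.2 = 0
  have hUV : U + V = S := Multiset.filter_add_not _ _
  have hU' : (U.map Prod.fst).map (AddMonoidHom.inl P G) = U := by
    rw [Multiset.map_map]
    refine (Multiset.map_congr rfl fun h hh => ?_).trans (Multiset.map_id U)
    exact Prod.ext rfl (Multiset.mem_filter.1 hh).2.symm
  have hUfree : ZeroSumFree (U.map Prod.fst) := by
    rw [← zeroSumFree_map_iff _ hl, hU']
    exact hS.mono (Multiset.filter_le _ _)
  have hUc : crossNumber U = crossNumber (U.map Prod.fst) := by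
    rw [← crossNumber_map _ hl, hU']
  -- The empty subsequence is allowed, so `C 0` holds trivially.
  let C : ℕ → Prop := fun j => ∀ x : P, p ^ j • x = 0 → ∃ T ≤ U.map Prod.fst, T.sum = x
  have hVfree : ∀ j, C j → ∀ T ≤ V, (p ^ j • T.sum.1 = 0 ∧ T.sum.2 = 0) → T = 0 := by
    rintro j hj T hT ⟨h1, h2⟩
    obtain ⟨W, hW, hWs⟩ := hj (-T.sum.1) (by rw [smul_neg, h1, neg_zero])
    have hWU : W.map (AddMonoidHom.inl P G) ≤ U := hU' ▸ Multiset.map_le_map hW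
    have h0 := hS (W.map (AddMonoidHom.inl P G) + T) (hUV ▸ add_le_add hWU hT) (by
      rw [Multiset.sum_add, ← map_multiset_sum, hWs]
      exact Prod.ext (by simp) (by simpa using h2))
    exact (add_eq_zero.1 h0).2
  have hdvd : ∀ g : G, addOrderOf g ∈ (AddMonoid.exponent G).divisors := fun g =>
    Nat.mem_divisors.2 ⟨AddMonoid.addOrder_dvd_exponent g, hN0⟩
  -- Terms with zero `G`-component lie in `U`, so the divisor 1 drops out and the error involves
  -- only the small sum over d > 1.
  have hD : ∀ h ∈ V, addOrderOf h.2 ∈ (AddMonoid.exponent G).divisors.erase 1 := fun h hh =>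
    Finset.mem_erase.2 ⟨fun h1 => (Multiset.mem_filter.1 hh).2 (AddMonoid.addOrderOf_eq_one_iff.1 h1),
      hdvd h.2⟩
  have hD' : ∀ d ∈ (AddMonoid.exponent G).divisors.erase 1, 0 < d ∧ ¬ p ∣ d := fun d hd => by
    have hd := Finset.mem_of_mem_erase hd
    exact ⟨Nat.pos_of_mem_divisors hd, fun h => hpN (h.trans (Nat.dvd_of_mem_divisors hd))⟩
  have hτ : 2 * ∑ d ∈ (AddMonoid.exponent G).divisors.erase 1, 1 / (d : ℝ) ≤ 1 / (p : ℝ) := by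
    have h1 := Finset.add_sum_erase _ (fun d : ℕ => 1 / (d : ℝ)) (Nat.one_mem_divisors.2 hN0)
    have h2 : (2 * (p : ℝ) + 2) / (2 * (p : ℝ) + 1) = 1 + 1 / (2 * (p : ℝ) + 1) := by
      field_simp
      ring
    have h3 : 2 * (1 / (2 * (p : ℝ) + 1)) ≤ 1 / (p : ℝ) := by
      rw [mul_one_div, div_le_div_iff₀ (by positivity) hp0]
      linarith
    rw [h2, ← h1] at hsmall
    norm_num at hsmall h3 ⊢
    linarith
  have hbound : ∀ j l', C j → (∀ x : P, p ^ (j + l') • x = 0) → crossNumber V ≤ littleCrossNumber G +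
      ∑ i ∈ Finset.range l', 1 / (p : ℝ) ^ (j + (i + 1)) * ((2 : ℕ) * ((p : ℝ) - 1) *
        ∑ d ∈ (AddMonoid.exponent G).divisors.erase 1, 1 / (d : ℝ)) := fun j l' hj hjl =>
    crossNumber_le_of_free j l' (fun _ => 2) (fun _ => le_rfl) hr hjl _ V hD hD' (hVfree j hj)
  rw [← hUV, crossNumber_add, hUc]
  by_cases hall : ∀ j, C j
  · have := hbound l 0 (hall l) (by simpa using hP)
    rw [Finset.sum_range_zero, add_zero] at this
    exact add_le_add hUfree.crossNumber_le this
  · have hC0 : C 0 := fun x hx => ⟨0, Multiset.zero_le _, by simpa using hx.symm⟩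
    obtain ⟨j, hj, hj'⟩ : ∃ j, C j ∧ ¬ C (j + 1) := by
      by_contra! h
      exact hall fun j => Nat.rec hC0 (fun j ih => h j ih) j
    simp only [C, not_forall] at hj'
    obtain ⟨x, hx, hxU⟩ := hj'
    have hU1 : crossNumber (U.map Prod.fst) + 1 / (p : ℝ) ^ (j + 1) ≤ littleCrossNumber P := by
      -- A zero-sum subsequence through `-x` would express `x` as a subsequence sum of `U`.
      have hfree : ZeroSumFree (-x ::ₘ U.map Prod.fst) := by
        intro T hT hT0
        by_cases hmem : -x ∈ T
        · obtain ⟨T', rfl⟩ := Multiset.exists_cons_of_mem hmem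
          refine absurd ⟨T', (Multiset.cons_le_cons_iff _).1 hT, ?_⟩ hxU
          rw [Multiset.sum_cons] at hT0
          exact (neg_add_eq_zero.1 hT0).symm
        · exact hUfree T ((Multiset.le_cons_of_notMem hmem).1 hT) hT0
      have h1 := hfree.crossNumber_le
      rw [crossNumber_cons, addOrderOf_neg] at h1
      have h2 : 1 / (p : ℝ) ^ (j + 1) ≤ 1 / (addOrderOf x : ℝ) :=
        one_div_le_one_div_of_le (by exact_mod_cast addOrderOf_pos x)
          (by
            exact_mod_cast Nat.le_of_dvd (pow_pos hpp.pos _) (addOrderOf_dvd_of_nsmul_eq_zero hx))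
      linarith
    have hV1 := hbound j l hj fun x => by rw [pow_add, mul_smul, hP, smul_zero]
    have hV2 : ∑ i ∈ Finset.range l, 1 / (p : ℝ) ^ (j + (i + 1)) * ((2 : ℕ) * ((p : ℝ) - 1) *
        ∑ d ∈ (AddMonoid.exponent G).divisors.erase 1, 1 / (d : ℝ)) ≤ 1 / (p : ℝ) ^ (j + 1) := by
      set τ := ∑ d ∈ (AddMonoid.exponent G).divisors.erase 1, 1 / (d : ℝ)
      have hτ0 : 0 ≤ τ := Finset.sum_nonneg fun d _ => by positivity
      calc _ = 1 / (p : ℝ) ^ j * (2 * τ) *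
            ∑ i ∈ Finset.range l, 1 / (p : ℝ) ^ (i + 1) * ((p : ℝ) - 1) := by
            conv_rhs => rw [Finset.mul_sum]
            refine Finset.sum_congr rfl fun i _ => ?_
            rw [pow_add, ← one_div_mul_one_div]
            push_cast
            ring
        _ ≤ 1 / (p : ℝ) ^ j * (2 * τ) * 1 := by
            rw [sum_one_div_pow hpp.one_lt]
            refine mul_le_mul_of_nonneg_left ?_ (by positivity)
            have : 0 ≤ 1 / (p : ℝ) ^ l := by positivity
            linarith
        _ ≤ 1 / (p : ℝ) ^ j * (1 / p) := by
            rw [mul_one]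
            exact mul_le_mul_of_nonneg_left hτ (by positivity)
        _ = _ := by rw [one_div_mul_one_div, pow_succ]
    linarith

/-! ### The groups `C_{p ^ m} ⊕ C_{p ^ n}` and the conclusion -/

/-- The rank of the `k`-th torsion layer of `C_{p ^ m} ⊕ C_{p ^ n}`. -/
def layerRank (m n k : ℕ) : ℕ := (if k < m then 1 else 0) + if k < n then 1 else 0

/-- The `p`-torsion of a cyclic group has at most `p` elements, and for `k ≥ m` multiplication by `p
^ k` is already zero. -/
theorem card_torsionLayer_zmod {p : ℕ} (hp : p.Prime) (m k : ℕ) :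
    Nat.card (torsionLayer (ZMod (p ^ m)) p k) ≤ p ^ (if k < m then 1 else 0) := by
  have : NeZero (p ^ m) := ⟨pow_ne_zero _ hp.ne_zero⟩
  split_ifs with h
  · have hk := IsAddCyclic.card_nsmulAddMonoidHom_ker (G := ZMod (p ^ m)) p
    rw [Nat.card_zmod] at hk
    refine (AddSubgroup.card_le_of_le (inf_le_left : torsionLayer (ZMod (p ^ m)) p k ≤ _)).trans ?_
    refine hk.trans_le ?_
    rw [pow_one]
    exact Nat.gcd_le_right _ hp.pos
  · have : torsionLayer (ZMod (p ^ m)) p k = ⊥ := by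
      refine (AddSubgroup.eq_bot_iff_forall _).2 fun x hx => ?_
      obtain ⟨-, y, rfl⟩ := mem_torsionLayer.1 hx
      obtain ⟨c, hc⟩ := pow_dvd_pow p (not_lt.1 h)
      rw [hc, mul_comm, mul_smul, nsmul_eq_mul (p ^ m), ZMod.natCast_self, zero_mul, smul_zero]
    rw [this]
    simp

theorem card_torsionLayer_prod {p : ℕ} (P Q : Type*) [AddCommGroup P] [AddCommGroup Q] [Finite P]
    [Finite Q] (k : ℕ) : Nat.card (torsionLayer (P × Q) p k) ≤
      Nat.card (torsionLayer P p k) * Nat.card (torsionLayer Q p k) := by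
  rw [← Nat.card_prod]
  refine Nat.card_le_card_of_injective (fun x : torsionLayer (P × Q) p k =>
    ((⟨x.1.1, ?_⟩ : torsionLayer P p k), (⟨x.1.2, ?_⟩ : torsionLayer Q p k))) ?_
  · obtain ⟨h, y, hy⟩ := mem_torsionLayer.1 x.2
    exact mem_torsionLayer.2 ⟨congrArg Prod.fst h, y.1, congrArg Prod.fst hy⟩
  · obtain ⟨h, y, hy⟩ := mem_torsionLayer.1 x.2
    exact mem_torsionLayer.2 ⟨congrArg Prod.snd h, y.2, congrArg Prod.snd hy⟩
  · intro x y h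
    simp only [Prod.mk.injEq, Subtype.mk.injEq] at h
    exact Subtype.ext (Prod.ext h.1 h.2)

theorem card_torsionLayer_zmod_prod {p : ℕ} (hp : p.Prime) (m n k : ℕ) :
    Nat.card (torsionLayer (ZMod (p ^ m) × ZMod (p ^ n)) p k) ≤ p ^ layerRank m n k := by
  have : NeZero (p ^ m) := ⟨pow_ne_zero _ hp.ne_zero⟩
  have : NeZero (p ^ n) := ⟨pow_ne_zero _ hp.ne_zero⟩
  rw [layerRank, pow_add]
  exact (card_torsionLayer_prod _ _ k).trans
    (Nat.mul_le_mul (card_torsionLayer_zmod hp m k) (card_torsionLayer_zmod hp n k))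

theorem pow_smul_zmod_prod (p m n : ℕ) (x : ZMod (p ^ m) × ZMod (p ^ n)) :
    p ^ (m + n) • x = 0 := by
  have h1 : p ^ m • x.1 = 0 := by rw [nsmul_eq_mul, ZMod.natCast_self, zero_mul]
  have h2 : p ^ n • x.2 = 0 := by rw [nsmul_eq_mul, ZMod.natCast_self, zero_mul]
  refine Prod.ext ?_ ?_
  · rw [Prod.smul_fst, pow_add, mul_comm, mul_smul, h1, smul_zero, Prod.fst_zero]
  · rw [Prod.smul_snd, pow_add, mul_smul, h2, smul_zero, Prod.snd_zero]

theorem sum_one_div_pow_ite {p : ℕ} (hp : 1 < p) {m l : ℕ} (h : m ≤ l) :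
    ∑ i ∈ Finset.range l, 1 / (p : ℝ) ^ (i + 1) * ((if i < m then 1 else 0) * ((p : ℝ) - 1)) =
      1 - 1 / (p : ℝ) ^ m := by
  rw [← sum_one_div_pow hp m, ← Finset.sum_subset (Finset.range_mono h)]
  · refine Finset.sum_congr rfl fun i hi => ?_
    rw [if_pos (Finset.mem_range.1 hi), one_mul]
  · intro i _ hi
    rw [if_neg (by simpa using hi), zero_mul, mul_zero]

theorem littleCrossNumber_zmod_prod_le {p : ℕ} [Fact p.Prime] (m n : ℕ) :
    littleCrossNumber (ZMod (p ^ m) × ZMod (p ^ n)) ≤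
      (1 - 1 / (p : ℝ) ^ m) + (1 - 1 / (p : ℝ) ^ n) := by
  have hp : p.Prime := Fact.out
  have : NeZero (p ^ m) := ⟨pow_ne_zero _ hp.ne_zero⟩
  have : NeZero (p ^ n) := ⟨pow_ne_zero _ hp.ne_zero⟩
  refine (littleCrossNumber_le_of_torsionLayer (m + n) (layerRank m n)
    (fun k => by unfold layerRank; split_ifs <;> omega) (card_torsionLayer_zmod_prod hp m n)
    (pow_smul_zmod_prod p m n)).trans_eq ?_
  rw [← sum_one_div_pow_ite hp.one_lt (Nat.le_add_right m n),
    ← sum_one_div_pow_ite hp.one_lt (Nat.le_add_left n m), ← Finset.sum_add_distrib]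
  refine Finset.sum_congr rfl fun i _ => ?_
  rw [layerRank]
  push_cast
  ring

theorem le_littleCrossNumber_zmod {N : ℕ} (hN : 0 < N) :
    1 - 1 / (N : ℝ) ≤ littleCrossNumber (ZMod N) := by
  have : NeZero N := ⟨hN.ne'⟩
  have hfree : ZeroSumFree (Multiset.replicate (N - 1) (1 : ZMod N)) := by
    intro T hT hT0
    obtain ⟨k, hk, rfl⟩ := Multiset.le_replicate_iff.1 hT
    rw [Multiset.sum_replicate, nsmul_one, ZMod.natCast_eq_zero_iff] at hT0
    obtain rfl : k = 0 := by
      by_contra h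
      have := Nat.le_of_dvd (Nat.pos_of_ne_zero h) hT0
      omega
    simp
  refine le_trans (le_of_eq ?_) hfree.crossNumber_le
  have hN0 : (N : ℝ) ≠ 0 := by exact_mod_cast hN.ne'
  rw [crossNumber, Multiset.map_replicate, Multiset.sum_replicate, ZMod.addOrderOf_one,
    nsmul_eq_mul, Nat.cast_sub hN]
  field_simp
  simp

/-- By `kStar_eq_sum` any decomposition may be used, here one of `G` enlarged by two summands, which
the two `none` indices label. -/
theorem kStar_zmod_prod {p : ℕ} (hp : p.Prime) (m n : ℕ) (G : Type*) [AddCommGroup G] [Finite G]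
    [Finite (ZMod (p ^ m) × ZMod (p ^ n) × G)] :
    kStar (ZMod (p ^ m) × ZMod (p ^ n) × G) =
      (1 - 1 / (p : ℝ) ^ m) + (1 - 1 / (p : ℝ) ^ n) + kStar G := by
  obtain ⟨r, q, a, hq, ⟨e⟩⟩ := exists_isPrimePowerDecomposition G
  let q' : Option (Option (Fin r)) → ℕ := fun o => o.elim p fun o => o.elim p q
  let a' : Option (Option (Fin r)) → ℕ := fun o => o.elim m fun o => o.elim n a
  let E : ZMod (p ^ m) × ZMod (p ^ n) × G ≃+ ((i : Option (Option (Fin r))) → ZMod (q' i ^ a' i)) :=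
    { toFun := fun x i => match i with
        | none => x.1
        | some none => x.2.1
        | some (some i) => e x.2.2 i
      invFun := fun y => (y none, y (some none), e.symm fun i => y (some (some i)))
      left_inv := fun x => Prod.ext rfl (Prod.ext rfl (e.symm_apply_apply _))
      right_inv := fun y => by
        funext i
        match i with
        | none => rfl
        | some none => rfl
        | some (some i) => exact congrFun (e.apply_symm_apply fun i => y (some (some i))) i
      map_add' := fun x y => by
        funext i
        match i with
        | none => rfl
        | some none => rfl
        | some (some i) => exact congrFun (map_add e x.2.2 y.2.2) i }
  have h' : IsPrimePowerDecomposition (ZMod (p ^ m) × ZMod (p ^ n) × G) q' a' := by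
    refine ⟨fun i => ?_, ⟨E⟩⟩
    match i with
    | none => exact hp
    | some none => exact hp
    | some (some i) => exact hq i
  rw [kStar_eq_sum h', kStar_eq_sum ⟨hq, ⟨e⟩⟩, Fintype.sum_option, Fintype.sum_option, add_assoc]
  rfl

end CrossNumber

theorem theorem7 {G : Type*} [AddCommGroup G] [Finite G] (p : ℕ) [Fact p.Prime]
    (hp : IsTwoSmall p (AddMonoid.exponent G)) (m n : ℕ) :
    littleCrossNumber (ZMod (p ^ m) × ZMod (p ^ n) × G) =
        littleCrossNumber (ZMod (p ^ m)) + littleCrossNumber (ZMod (p ^ n)) +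
          littleCrossNumber G ∧
      (littleCrossNumber G = kStar G →
        littleCrossNumber (ZMod (p ^ m) × ZMod (p ^ n) × G) =
          kStar (ZMod (p ^ m) × ZMod (p ^ n) × G)) := by
  have hpp : p.Prime := Fact.out
  have : NeZero (p ^ m) := ⟨pow_ne_zero _ hpp.ne_zero⟩
  have : NeZero (p ^ n) := ⟨pow_ne_zero _ hpp.ne_zero⟩
  have hm := le_littleCrossNumber_zmod (pow_pos hpp.pos m)
  have hn := le_littleCrossNumber_zmod (pow_pos hpp.pos n)
  have hlow := add_le_littleCrossNumber_prod (ZMod (p ^ m)) (ZMod (p ^ n))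
  have hup := littleCrossNumber_zmod_prod_le (p := p) m n
  have hlow' := add_le_littleCrossNumber_prod (ZMod (p ^ m) × ZMod (p ^ n)) G
  have hup' := littleCrossNumber_prod_le (P := ZMod (p ^ m) × ZMod (p ^ n)) (m + n)
    (pow_smul_zmod_prod p m n) (fun k => (card_torsionLayer_zmod_prod hpp m n k).trans
      (Nat.pow_le_pow_right hpp.pos (by unfold layerRank; split_ifs <;> omega))) hp
  push_cast at hm hn
  rw [← littleCrossNumber_congr (AddEquiv.prodAssoc : (ZMod (p ^ m) × ZMod (p ^ n)) × G ≃+ _)]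
  -- The upper bound for the rank-two part equals the sum of the lower bounds for its cyclic
  -- factors, so all these inequalities are equalities.
  refine ⟨by linarith, fun hG => ?_⟩
  rw [kStar_zmod_prod hpp]
  linarith
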